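/- For $u,v\in\mathbb R^2$ let $[u,v]=u_1v_2-u_2v_1$. A smooth curve $\gamma:\mathbb R\to\mathbb R^2$ is centroaffine if $[\gamma(t),\gamma'(t)]=1$ for all $t$; then $\gamma''=p\gamma$, where $p=[\gamma'',\gamma']$ is its centroaffine curvature. It is $\pi$-antisymmetric if $\gamma(t+\pi)=-\gamma(t)$ for all $t$, and closed if it is periodic with some positive period. Two centroaffine curves $\gamma,\delta$ are $c$-related if $[\gamma(t),\delta(t)]=c$ for all $t$. Theorem. Let $\gamma$ be a $\pi$-antisymmetric centroaffine curve with centroaffine curvature $p$. Among the real $\lambda$ for which the Hill equation $y''+(\lambda-p(t))y=0$ has a nontrivial real $\pi$-periodic solution there is a least one, $\lambda_0$, and $\lambda_0<0$. For every $c\in\mathbb R$, there is a closed centroaffine curve that is $c$-related to $\gamma$ if and only if $|c|\le 1/\sqrt{-\lambda_0}$; the same equivalence holds if "closed" is replaced by "$\pi$-antisymmetric". Moreover, with $P=-\frac1\pi\int_0^\pi p(t)\,dt$, one has $\lambda_0\le -P$. Consequently, if $P>0$ and $\gamma$ admits a closed centroaffine $c$-related curve (in particular, a $\pi$-antisymmetric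 one), then $|c|\le 1/\sqrt P$. -/

import Mathlib

open scoped ContDiff

noncomputable section

/-- The standard area form `[u, v]` (the determinant) on the plane `ℝ²`. -/
def areaForm (u v : Fin 2 → ℝ) : ℝ := u 0 * v 1 - u 1 * v 0

/-- A smooth parametrized plane curve with `[γ, γ'] = 1` everywhere. -/
structure IsCentroaffine (γ : ℝ → Fin 2 → ℝ) : Prop where
  smooth : ContDiff ℝ ∞ γ
  wronskian : ∀ t, areaForm (γ t) (deriv γ t) = 1

/-- `π`-antisymmetry: `γ (t + π) = - γ t` for all `t`. -/
def IsPiAntisymmetric (γ : ℝ → Fin 2 → ℝ) : Prop := Function.Antiperiodic γ Real.pi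

/-- A parametrized curve is closed if it is periodic with some positive period. -/
def IsClosedCurve (γ : ℝ → Fin 2 → ℝ) : Prop := ∃ T : ℝ, 0 < T ∧ Function.Periodic γ T

/-- Two curves are `c`-related if `[γ t, δ t] = c` for all `t`. -/
def CRelated (c : ℝ) (γ δ : ℝ → Fin 2 → ℝ) : Prop := ∀ t, areaForm (γ t) (δ t) = c

/-- The centroaffine curvature `p = [γ'', γ']`; for a centroaffine curve, it is the
function `p` with `γ'' = p γ`. -/
def centroaffineCurvature (γ : ℝ → Fin 2 → ℝ) (t : ℝ) : ℝ :=
  areaForm (deriv (deriv γ) t) (deriv γ t)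

/-- `y` is a solution on the whole line of the Hill equation `y'' + (lam - p) y = 0`. -/
structure IsHillSolution (p : ℝ → ℝ) (lam : ℝ) (y : ℝ → ℝ) : Prop where
  differentiable : Differentiable ℝ y
  differentiable_deriv : Differentiable ℝ (deriv y)
  equation : ∀ t, deriv (deriv y) t + (lam - p t) * y t = 0

/-- The set of `π`-periodic eigenvalues of the Hill equation: the real `lam` for which
`y'' + (lam - p) y = 0` has a nontrivial `π`-periodic solution. -/
def periodicEigenvalues (p : ℝ → ℝ) : Set ℝ :=
  {lam | ∃ y : ℝ → ℝ, IsHillSolution p lam y ∧ Function.Periodic y Real.pi ∧ ∃ t, y t ≠ 0}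

/-- The number `P = -(1/π) ∫₀^π p(t) dt`. -/
def negMean (p : ℝ → ℝ) : ℝ := -(1 / Real.pi) * ∫ t in (0 : ℝ)..Real.pi, p t

end

open Set Filter Topology Function
open scoped NNReal

/-! For `c ≠ 0`, a curve `c`-related to `γ` has the form `δ = c (γ' - w γ)`, and `δ` is centroaffine
exactly when `w' = p - lam - w ^ 2` with `lam = -1 / c ^ 2`. The question thus becomes for which
`lam` this Riccati equation has a global, or a `π`-periodic, solution.

The parameters with a periodic solution form a ray, since a solution for `lam` is a strict lower
solution for any smaller parameter; compactness gives the ray a greatest element `lam0`. There `w`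
has mean zero, as otherwise `w` perturbs to ordered lower and upper solutions for a larger
parameter. Hence `exp (∫ w)` is a positive periodic Hill solution, and comparing any periodic Hill
solution with it shows that `lam0` is the least eigenvalue. Beyond `lam0` every Riccati solution
blows up in finite time, so the bound on `c` is necessary for every `c`-related centroaffine curve,
while periodic `w` gives an antisymmetric `δ`. Antisymmetry of `γ` forces `lam0 < 0`, and
integrating the Riccati equation over a period gives `lam0 ≤ -P`. -/

/-! ### Periodic solutions of scalar Lipschitz equations -/

theorem exists_solution_of_bounded_lipschitz {v : ℝ → ℝ → ℝ} {K : ℝ≥0} {L b : ℝ} (hb : 0 ≤ b)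
    (hlip : ∀ t, LipschitzWith K (v t)) (hcont : ∀ x, Continuous fun t => v t x)
    (hL : ∀ t x, |v t x| ≤ L) (x : ℝ) :
    ∃ w : ℝ → ℝ, w 0 = x ∧ ∀ t ∈ Icc 0 b, HasDerivWithinAt w (v t (w t)) (Icc 0 b) t := by
  have hL0 : 0 ≤ L := (abs_nonneg _).trans (hL 0 0)
  have h : IsPicardLindelof v (tmin := 0) (tmax := b) ⟨0, le_rfl, hb⟩ x
      ⟨L * b, mul_nonneg hL0 hb⟩ 0 ⟨L, hL0⟩ K := by
    refine ⟨fun t _ => (hlip t).lipschitzOnWith, fun y _ => (hcont y).continuousOn,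
      fun t _ y _ => hL t y, ?_⟩
    simp only [sub_zero, sub_self, max_eq_left hb, NNReal.coe_zero]
    exact le_rfl
  exact h.exists_eq_forall_mem_Icc_hasDerivWithinAt₀

theorem HasDerivWithinAt.Ici_of_mem_Ico {w : ℝ → ℝ} {w' a b t : ℝ} (ht : t ∈ Ico a b)
    (h : HasDerivWithinAt w w' (Icc a b) t) : HasDerivWithinAt w w' (Ici t) t :=
  h.mono_of_mem_nhdsWithin (Icc_mem_nhdsGE_of_mem ht)

/-- A solution on `[0, 2 T]` of a `T`-periodic equation with `w T = w 0` extends from `[0, T]` to a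
`T`-periodic solution on the line. -/
theorem exists_periodic_solution {v : ℝ → ℝ → ℝ} {K : ℝ≥0} {T : ℝ} (hT : 0 < T)
    (hlip : ∀ t, LipschitzWith K (v t)) (hper : ∀ x, Periodic (fun t => v t x) T) {w : ℝ → ℝ}
    (hw : ∀ t ∈ Icc 0 (2 * T), HasDerivWithinAt w (v t (w t)) (Icc 0 (2 * T)) t)
    (hwT : w T = w 0) :
    ∃ W : ℝ → ℝ, Periodic W T ∧ (∀ t, HasDerivAt W (v t (W t)) t) ∧
      ∀ t ∈ Icc 0 T, W t = w t := by
  have hshift : ∀ t ∈ Icc 0 T, w t = w (t + T) := by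
    have hc : ContinuousOn w (Icc 0 (2 * T)) := fun t ht => (hw t ht).continuousWithinAt
    intro t ht
    -- By periodicity of `v`, the shift of `w` by `T` solves the same equation with the same initial
    -- value, so uniqueness applies.
    have := dist_le_of_trajectories_ODE (f := w) (g := fun t => w (t + T)) (v := v) (K := K)
      (a := 0) (b := T) (δ := 0) hlip (hc.mono (Icc_subset_Icc le_rfl (by linarith)))
      (fun t ht => (hw t ⟨ht.1, by linarith [ht.2]⟩).Ici_of_mem_Ico ⟨ht.1, by linarith [ht.2]⟩)
      (hc.comp (by fun_prop) fun t ht => ⟨by linarith [ht.1], by linarith [ht.2]⟩)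
      (fun t ht => by
        have h1 := (hw (t + T) ⟨by linarith [ht.1], by linarith [ht.2]⟩).Ici_of_mem_Ico
          ⟨by linarith [ht.1], by linarith [ht.2]⟩
        rw [show v (t + T) (w (t + T)) = v t (w (t + T)) from hper _ t] at h1
        have h2 : HasDerivWithinAt (fun s : ℝ => s + T) 1 (Ici t) t :=
          ((hasDerivAt_id t).add_const T).hasDerivWithinAt
        simpa [Function.comp_def] using h1.comp t h2 (fun s hs => by
          simp only [mem_Ici] at hs ⊢; linarith))
      (by simp [hwT]) t ht
    rw [zero_mul] at this
    exact dist_le_zero.1 this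
  let W : ℝ → ℝ := fun t => w (toIcoMod hT 0 t)
  have hWper : Periodic W T := fun t => by simp only [W, toIcoMod_add_right]
  have hW1 : ∀ t ∈ Icc 0 T, W t = w t := by
    intro t ht
    rcases ht.2.eq_or_lt with rfl | h
    · have : toIcoMod hT 0 t = 0 := by simpa using toIcoMod_apply_right hT 0
      simp only [W, this, hwT]
    · simp only [W]
      rw [(toIcoMod_eq_self hT).2 ⟨ht.1, by simpa using h⟩]
  have hW2 : ∀ t ∈ Icc 0 (2 * T), W t = w t := by
    intro t ht
    rcases le_total t T with h | h
    · exact hW1 t ⟨ht.1, h⟩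
    · have h0 : t - T ∈ Icc 0 T := ⟨by linarith, by linarith [ht.2]⟩
      rw [← sub_add_cancel t T, hWper (t - T), hW1 _ h0, hshift _ h0]
  refine ⟨W, hWper, fun t => ?_, hW1⟩
  -- The representative in `[T / 2, 3 T / 2)` is interior to `[0, 2 T]`, where one-sided derivatives
  -- become two-sided.
  set s := toIcoMod hT (T / 2) t with hs
  have hs1 : s ∈ Ioo 0 (2 * T) := by
    have := toIcoMod_mem_Ico hT (T / 2) t
    exact ⟨by linarith [this.1], by linarith [this.2]⟩
  have hts : s = t - toIcoDiv hT (T / 2) t * T := by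
    rw [hs, toIcoMod, zsmul_eq_mul]
  have hd : HasDerivAt W (v s (W s)) s := by
    rw [hW2 s (Ioo_subset_Icc_self hs1)]
    refine ((hw s (Ioo_subset_Icc_self hs1)).hasDerivAt
      (Icc_mem_nhds hs1.1 hs1.2)).congr_of_eventuallyEq ?_
    filter_upwards [Icc_mem_nhds hs1.1 hs1.2] with r hr using hW2 r hr
  have hWs : ∀ r, W (r - toIcoDiv hT (T / 2) t * T) = W r := fun r => hWper.sub_int_mul_eq _
  have hv : ∀ x, v s x = v t x := fun x => by
    rw [hts]; exact (hper x).sub_int_mul_eq _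
  rw [hv, hts, hWs] at hd
  simpa only [hWs] using hd.comp_sub_const t (toIcoDiv hT (T / 2) t * T)

/-! ### The truncated Riccati equation and its flow -/

/-- The right-hand side of `w' = q - w ^ 2`, with the quadratic term frozen outside `[-M, M]`. -/
noncomputable def truncatedRiccati (M : ℝ) (q : ℝ → ℝ) (t x : ℝ) : ℝ :=
  q t - (max (-M) (min x M)) ^ 2

theorem abs_clamp_le {M : ℝ} (hM : 0 ≤ M) (x : ℝ) : |max (-M) (min x M)| ≤ M :=
  abs_le.2 ⟨le_max_left _ _, max_le (by linarith) (min_le_right _ _)⟩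

theorem clamp_eq_self {M x : ℝ} (hx : |x| ≤ M) : max (-M) (min x M) = x := by
  rw [min_eq_left (abs_le.1 hx).2, max_eq_right (abs_le.1 hx).1]

theorem truncatedRiccati_eq {M x : ℝ} (q : ℝ → ℝ) (t : ℝ) (hx : |x| ≤ M) :
    truncatedRiccati M q t x = q t - x ^ 2 := by
  rw [truncatedRiccati, clamp_eq_self hx]

/-- Clamping is 1-Lipschitz and a difference of squares costs a factor `2 M`; the extra `1` keeps
the constant positive for the Grönwall formula. -/
theorem lipschitzWith_truncatedRiccati {M : ℝ≥0} (q : ℝ → ℝ) (t : ℝ) :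
    LipschitzWith (2 * M + 1) (truncatedRiccati M q t) := by
  refine LipschitzWith.of_dist_le_mul fun x y => ?_
  rw [Real.dist_eq, Real.dist_eq, truncatedRiccati, truncatedRiccati]
  have hx := abs_clamp_le M.2 x
  have hy := abs_clamp_le M.2 y
  have h : |max (-(M : ℝ)) (min x M) - max (-(M : ℝ)) (min y M)| ≤ |x - y| := by
    refine (abs_max_sub_max_le_max _ _ _ _).trans (max_le (by simp) ?_)
    exact (abs_min_sub_min_le_max _ _ _ _).trans (max_le le_rfl (by simp))
  simp only [NNReal.val_eq_coe] at hx hy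
  set X := max (-(M : ℝ)) (min x M)
  set Y := max (-(M : ℝ)) (min y M)
  have e : q t - X ^ 2 - (q t - Y ^ 2) = -((X + Y) * (X - Y)) := by ring
  rw [e, abs_neg, abs_mul]
  have hXY : |X + Y| ≤ 2 * M + 1 := (abs_add_le _ _).trans (by linarith)
  push_cast
  exact mul_le_mul hXY h (abs_nonneg _) (by positivity)

theorem abs_truncatedRiccati_le {M : ℝ} (hM : 0 ≤ M) {q : ℝ → ℝ} {C : ℝ} (hq : ∀ t, |q t| ≤ C)
    (t x : ℝ) : |truncatedRiccati M q t x| ≤ C + M ^ 2 := by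
  rw [truncatedRiccati]
  refine (abs_sub _ _).trans (add_le_add (hq t) ?_)
  rw [abs_pow]
  exact pow_le_pow_left₀ (abs_nonneg _) (abs_clamp_le hM x) 2

theorem Function.Periodic.exists_abs_le {f : ℝ → ℝ} {T : ℝ} (hf : Periodic f T) (hT : 0 < T)
    (hc : Continuous f) : ∃ C, 0 ≤ C ∧ ∀ t, |f t| ≤ C := by
  obtain ⟨C, hC⟩ := (hf.isBounded_of_continuous hT.ne' hc).exists_norm_le
  exact ⟨C, (norm_nonneg _).trans (hC _ (mem_range_self 0)), fun t => hC _ (mem_range_self t)⟩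

/-- The flow of the truncated Riccati equation, continuous in the spectral parameter `z.1` and the
initial value `z.2`. -/
theorem exists_truncatedRiccati_flow {M : ℝ≥0} {p : ℝ → ℝ} {C b : ℝ} (hb : 0 ≤ b)
    (hp : Continuous p) (hC : ∀ t, |p t| ≤ C) :
    ∃ W : ℝ × ℝ → ℝ → ℝ, (∀ z, W z 0 = z.2 ∧ ∀ t ∈ Icc 0 b,
      HasDerivWithinAt (W z) (truncatedRiccati M (fun s => p s - z.1) t (W z t)) (Icc 0 b) t) ∧
      ∀ t ∈ Icc 0 b, Continuous fun z => W z t := by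
  have hex : ∀ z : ℝ × ℝ, ∃ w : ℝ → ℝ, w 0 = z.2 ∧ ∀ t ∈ Icc 0 b,
      HasDerivWithinAt w (truncatedRiccati M (fun s => p s - z.1) t (w t)) (Icc 0 b) t := by
    intro z
    refine exists_solution_of_bounded_lipschitz hb (lipschitzWith_truncatedRiccati _)
      (fun x => by unfold truncatedRiccati; fun_prop)
      (abs_truncatedRiccati_le M.2 (C := C + |z.1|) fun t => ?_) z.2
    exact (abs_sub _ _).trans (by linarith [hC t])
  choose W hW0 hW using hex
  refine ⟨W, fun z => ⟨hW0 z, hW z⟩, fun t ht => ?_⟩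
  have hc : ∀ z, ContinuousOn (W z) (Icc 0 b) := fun z t ht => (hW z t ht).continuousWithinAt
  set K : ℝ≥0 := 2 * M + 1 with hK
  have hKpos : (0 : ℝ) < K := by rw [hK]; push_cast; positivity
  have hE : 0 ≤ Real.exp (K * t) - 1 := by
    have := Real.add_one_le_exp (K * t); nlinarith [ht.1]
  refine (LipschitzWith.of_dist_le' (K := Real.exp (K * t) + (Real.exp (K * t) - 1) / K)
    fun z z' => ?_).continuous
  -- A change of spectral parameter enters Grönwall's inequality as a constant error `dist z.1 z'.1`
  -- in the equation.
  have h := dist_le_of_approx_trajectories_ODE (f := W z) (g := W z')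
    (v := truncatedRiccati M fun s => p s - z.1) (K := K) (a := 0) (b := b) (εf := 0)
    (εg := dist z.1 z'.1) (δ := dist z.2 z'.2) (lipschitzWith_truncatedRiccati _)
    (hc z) (fun t ht => (hW z t (Ico_subset_Icc_self ht)).Ici_of_mem_Ico ht)
    (fun t _ => by rw [dist_self])
    (hc z') (fun t ht => (hW z' t (Ico_subset_Icc_self ht)).Ici_of_mem_Ico ht)
    (fun t _ => by
      simp only [truncatedRiccati, Real.dist_eq]
      exact le_of_eq (congrArg _ (by ring)))
    (by rw [hW0, hW0]) t ht
  rw [gronwallBound_of_K_ne_0 hKpos.ne'] at h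
  simp only [zero_add, sub_zero] at h
  refine h.trans ?_
  have h1 : dist z.1 z'.1 ≤ dist z z' := le_max_left _ _
  have h2 : dist z.2 z'.2 ≤ dist z z' := le_max_right _ _
  calc _ ≤ dist z z' * Real.exp (K * t) + dist z z' / K * (Real.exp (K * t) - 1) := by gcongr
    _ = _ := by ring

/-! ### The Riccati spectrum is a ray with a greatest element -/

/-- The parameters `lam` for which the Riccati equation `w' = p - lam - w ^ 2` has a `T`-periodic
solution. -/
def riccatiSpectrum (T : ℝ) (p : ℝ → ℝ) : Set ℝ :=
  {lam | ∃ w : ℝ → ℝ, Periodic w T ∧ ∀ t, HasDerivAt w (p t - lam - w t ^ 2) t}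

theorem truncatedRiccati_periodic {T : ℝ} {q : ℝ → ℝ} (hq : Periodic q T) (M x : ℝ) :
    Periodic (fun t => truncatedRiccati M q t x) T := fun t => by
  simp only [truncatedRiccati, hq t]

/-- A `T`-periodic Riccati equation with ordered strict periodic lower and upper solutions has a
periodic solution. -/
theorem exists_periodic_riccati_of_lower_upper {T : ℝ} (hT : 0 < T) {q A B A' B' : ℝ → ℝ}
    (hq : Continuous q) (hqT : Periodic q T) (hA : Periodic A T) (hB : Periodic B T)
    (hA' : ∀ t, HasDerivAt A (A' t) t) (hB' : ∀ t, HasDerivAt B (B' t) t)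
    (hAq : ∀ t, A' t < q t - A t ^ 2) (hBq : ∀ t, q t - B t ^ 2 < B' t) (hAB : A 0 ≤ B 0) :
    ∃ w : ℝ → ℝ, Periodic w T ∧ ∀ t, HasDerivAt w (q t - w t ^ 2) t := by
  have hAc : Continuous A := continuous_iff_continuousAt.2 fun t => (hA' t).continuousAt
  have hBc : Continuous B := continuous_iff_continuousAt.2 fun t => (hB' t).continuousAt
  obtain ⟨C, -, hC⟩ := hqT.exists_abs_le hT hq
  obtain ⟨a, ha0, ha⟩ := hA.exists_abs_le hT hAc
  obtain ⟨b, hb0, hb⟩ := hB.exists_abs_le hT hBc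
  -- This bound dominates both `A` and `B`, so the truncation is inactive between them.
  let M : ℝ≥0 := ⟨a + b, add_nonneg ha0 hb0⟩
  have hMa : ∀ t, |A t| ≤ M := fun t => (ha t).trans (le_add_of_nonneg_right hb0)
  have hMb : ∀ t, |B t| ≤ M := fun t => (hb t).trans (le_add_of_nonneg_left ha0)
  obtain ⟨W, hW, hWc⟩ := exists_truncatedRiccati_flow (M := M) (b := 2 * T) (by linarith) hq hC
  have hWcont : ∀ z, ContinuousOn (W z) (Icc 0 (2 * T)) :=
    fun z t ht => ((hW z).2 t ht).continuousWithinAt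
  have htrap : ∀ x ∈ Icc (A 0) (B 0), ∀ t ∈ Icc 0 (2 * T),
      W (0, x) t ∈ Icc (A t) (B t) := by
    intro x hx t ht
    have hd := (hW (0, x)).2
    simp only [sub_zero] at hd
    constructor
    · refine image_le_of_deriv_right_lt_deriv_boundary' hAc.continuousOn
        (fun s _ => (hA' s).hasDerivWithinAt) (by rw [(hW _).1]; exact hx.1) (hWcont _)
        (fun s hs => (hd s (Ico_subset_Icc_self hs)).Ici_of_mem_Ico hs)
        (fun s _ h => ?_) ht
      rw [← h, truncatedRiccati_eq _ _ (hMa s)]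
      exact hAq s
    · refine image_le_of_deriv_right_lt_deriv_boundary' (hWcont _)
        (fun s hs => (hd s (Ico_subset_Icc_self hs)).Ici_of_mem_Ico hs)
        (by rw [(hW _).1]; exact hx.2) hBc.continuousOn
        (fun s _ => (hB' s).hasDerivWithinAt) (fun s _ h => ?_) ht
      rw [h, truncatedRiccati_eq _ _ (hMb s)]
      exact hBq s
  have hT2 : T ∈ Icc 0 (2 * T) := ⟨hT.le, by linarith⟩
  -- The period map sends `[A 0, B 0]` into itself; a fixed point is the initial value of a periodic
  -- solution.
  obtain ⟨x, hx, hfix⟩ := exists_mem_Icc_isFixedPt_of_mapsTo (f := fun x => W (0, x) T)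
    ((hWc T hT2).comp (by fun_prop : Continuous fun x : ℝ => ((0 : ℝ), x))).continuousOn hAB
    (fun x hx => by
      have := htrap x hx T hT2
      rwa [← zero_add T, hA 0, hB 0, zero_add] at this)
  have hd := (hW (0, x)).2
  simp only [sub_zero] at hd
  obtain ⟨w, hwT, hw, hwW⟩ := exists_periodic_solution hT (lipschitzWith_truncatedRiccati (M := M) q)
    (truncatedRiccati_periodic hqT M) hd (by rw [(hW _).1]; exact hfix)
  refine ⟨w, hwT, fun t => ?_⟩
  have habs : |w t| ≤ M := by
    obtain ⟨s, hs, hst⟩ := hwT.exists_mem_Ico₀ hT t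
    have h1 := htrap x hx s ⟨hs.1, by linarith [hs.2]⟩
    rw [hst, hwW s (Ico_subset_Icc_self hs)]
    exact abs_le.2 ⟨(abs_le.1 (hMa s)).1.trans h1.1, h1.2.trans (abs_le.1 (hMb s)).2⟩
  have := hw t
  rwa [truncatedRiccati_eq _ _ habs] at this

theorem Function.Periodic.exists_forall_le {f : ℝ → ℝ} {T : ℝ} (hf : Periodic f T) (hT : 0 < T)
    (hc : Continuous f) : ∃ s, ∀ t, f t ≤ f s := by
  obtain ⟨_, ⟨s, rfl⟩, hs⟩ := (hf.compact_of_continuous hT.ne' hc).exists_isGreatest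
    (range_nonempty f)
  exact ⟨s, fun t => hs (mem_range_self t)⟩

/-- At a maximum of `w ^ 2` the product `w w'` vanishes, so either `w` is zero there or `hcrit`
applies. -/
theorem abs_le_of_periodic_of_critical {T M : ℝ} (hT : 0 < T) (hM : 0 ≤ M) {w w' : ℝ → ℝ}
    (hwT : Periodic w T) (hw : ∀ t, HasDerivAt w (w' t) t)
    (hcrit : ∀ t, w' t = 0 → |w t| ≤ M) (t : ℝ) : |w t| ≤ M := by
  have hc : Continuous w := continuous_iff_continuousAt.2 fun t => (hw t).continuousAt
  obtain ⟨s, hs⟩ := Periodic.exists_forall_le (f := fun t => w t ^ 2)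
    (fun t => by simp only [hwT t]) hT (by fun_prop)
  refine (sq_le_sq.1 (hs t)).trans ?_
  have h0 : 2 * w s * w' s = 0 := by
    have hmax : IsLocalMax (fun t => w t ^ 2) s := Eventually.of_forall hs
    have := hmax.hasDerivAt_eq_zero ((hw s).pow 2)
    simpa using this
  rcases mul_eq_zero.1 h0 with h | h
  · have : w s = 0 := by linarith
    simpa [this] using hM
  · exact hcrit s h

theorem riccatiSpectrum_le {T C lam : ℝ} (hT : 0 < T) {p : ℝ → ℝ} (hC : ∀ t, |p t| ≤ C)
    (h : lam ∈ riccatiSpectrum T p) : lam ≤ C := by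
  obtain ⟨w, hwT, hw⟩ := h
  have hc : Continuous w := continuous_iff_continuousAt.2 fun t => (hw t).continuousAt
  obtain ⟨s, hs⟩ := hwT.exists_forall_le hT hc
  have hmax : IsLocalMax w s := Eventually.of_forall hs
  have := hmax.hasDerivAt_eq_zero (hw s)
  nlinarith [(abs_le.1 (hC s)).2, sq_nonneg (w s)]

/-- A lower solution suffices, because any large enough constant is a strict upper solution above
it. -/
theorem mem_riccatiSpectrum_of_forall_lt {T lam : ℝ} (hT : 0 < T) {p A A' : ℝ → ℝ}
    (hp : Continuous p) (hpT : Periodic p T) (hA : Periodic A T)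
    (hA' : ∀ t, HasDerivAt A (A' t) t) (hAp : ∀ t, A' t < p t - lam - A t ^ 2) :
    lam ∈ riccatiSpectrum T p := by
  have hAc : Continuous A := continuous_iff_continuousAt.2 fun t => (hA' t).continuousAt
  obtain ⟨C, hC0, hC⟩ := hpT.exists_abs_le hT hp
  obtain ⟨a, ha0, ha⟩ := hA.exists_abs_le hT hAc
  have hl := abs_nonneg lam
  refine exists_periodic_riccati_of_lower_upper (B := fun _ => C + a + |lam| + 1)
    (B' := fun _ => 0) hT (by fun_prop) (fun t => by simp only [hpT t]) hA (fun _ => rfl) hA'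
    (fun t => hasDerivAt_const t _) hAp (fun t => ?_) ?_
  · nlinarith [(abs_le.1 (hC t)).2, neg_abs_le lam]
  · linarith [(abs_le.1 (ha 0)).2]

theorem mem_riccatiSpectrum_of_lt {T lam mu : ℝ} (hT : 0 < T) {p : ℝ → ℝ}
    (hp : Continuous p) (hpT : Periodic p T) (h : lam ∈ riccatiSpectrum T p) (hmu : mu < lam) :
    mu ∈ riccatiSpectrum T p := by
  obtain ⟨w, hwT, hw⟩ := h
  exact mem_riccatiSpectrum_of_forall_lt hT hp hpT hwT hw fun t => by linarith

/-- With the parameter confined to `[-C - 1, C]`, periodic solutions are uniformly bounded by `M`.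
They then correspond to the fixed points of the truncated period map, a compact set of pairs
(parameter, initial value) on which the parameter attains its maximum. -/
theorem exists_isGreatest_riccatiSpectrum {T : ℝ} (hT : 0 < T) {p : ℝ → ℝ}
    (hp : Continuous p) (hpT : Periodic p T) : ∃ lam, IsGreatest (riccatiSpectrum T p) lam := by
  obtain ⟨C, hC0, hC⟩ := hpT.exists_abs_le hT hp
  -- For `lam ≥ -C - 1` one has `p - lam ≤ 2 C + 1 < M ^ 2`, so no critical point of a solution lies
  -- outside `[-M, M]`.
  let M : ℝ≥0 := ⟨2 * C + 2, by linarith⟩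
  have hMdef : (M : ℝ) = 2 * C + 2 := rfl
  obtain ⟨W, hW, hWc⟩ := exists_truncatedRiccati_flow (M := M) (b := 2 * T) (by linarith) hp hC
  have hT2 : T ∈ Icc 0 (2 * T) := ⟨hT.le, by linarith⟩
  have hqT : ∀ lam, Periodic (fun t => p t - lam) T := fun lam t => by simp only [hpT t]
  have hlt : ∀ lam ∈ Icc (-C - 1) C, ∀ t, p t - lam < (M : ℝ) ^ 2 := by
    intro lam hlam t
    rw [hMdef]
    nlinarith [(abs_le.1 (hC t)).2, hlam.1]
  have hfix : ∀ z : ℝ × ℝ, z.1 ∈ Icc (-C - 1) C → W z T = z.2 → z.1 ∈ riccatiSpectrum T p := by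
    intro z hz h
    obtain ⟨w, hwT, hw, -⟩ := exists_periodic_solution hT
      (lipschitzWith_truncatedRiccati (M := M) _) (truncatedRiccati_periodic (hqT z.1) M) (hW z).2
      (by rw [(hW z).1, h])
    have habs := abs_le_of_periodic_of_critical hT M.coe_nonneg hwT hw fun t ht => by
      by_contra! hlt'
      have hsq : (max (-(M : ℝ)) (min (w t) M)) ^ 2 = (M : ℝ) ^ 2 := by
        rcases lt_abs.1 hlt' with h' | h'
        · rw [min_eq_right (show (M : ℝ) ≤ w t from h'.le),
            max_eq_right (by linarith [M.coe_nonneg, show (M : ℝ) < w t from h'])]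
        · have h'' : w t ≤ -(M : ℝ) := by have : (M : ℝ) < -w t := h'; linarith
          rw [max_eq_left ((min_le_left _ _).trans h'')]
          ring
      rw [truncatedRiccati, hsq] at ht
      linarith [hlt z.1 hz t]
    refine ⟨w, hwT, fun t => ?_⟩
    have := hw t
    rwa [truncatedRiccati_eq _ _ (habs t)] at this
  have hconv : ∀ lam ∈ Icc (-C - 1) C, lam ∈ riccatiSpectrum T p →
      ∃ x ∈ Icc (-(M : ℝ)) M, W (lam, x) T = x := by
    rintro lam hlam ⟨w, hwT, hw⟩
    have habs := abs_le_of_periodic_of_critical hT M.coe_nonneg hwT hw fun t ht =>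
      abs_le_of_sq_le_sq (by linarith [hlt lam hlam t]) M.coe_nonneg
    refine ⟨w 0, abs_le.1 (habs 0), ?_⟩
    have := dist_le_of_trajectories_ODE (f := W (lam, w 0)) (g := w)
      (v := truncatedRiccati M fun t => p t - lam) (a := 0) (b := 2 * T) (δ := 0)
      (lipschitzWith_truncatedRiccati _)
      (fun t ht => ((hW _).2 t ht).continuousWithinAt)
      (fun t ht => ((hW _).2 t (Ico_subset_Icc_self ht)).Ici_of_mem_Ico ht)
      (fun t _ => (hw t).continuousAt.continuousWithinAt)
      (fun t _ => by rw [truncatedRiccati_eq _ _ (habs t)]; exact (hw t).hasDerivWithinAt)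
      (by rw [(hW _).1, dist_self]) T hT2
    rw [zero_mul] at this
    rw [dist_le_zero.1 this]
    simpa using hwT 0
  have hbot : -C - 1 ∈ riccatiSpectrum T p :=
    mem_riccatiSpectrum_of_forall_lt hT hp hpT (A := fun _ => 0) (A' := fun _ => 0) (fun _ => rfl)
      (fun t => hasDerivAt_const t _) fun t => by linarith [(abs_le.1 (hC t)).1]
  let S : Set (ℝ × ℝ) := (Icc (-C - 1) C ×ˢ Icc (-(M : ℝ)) M) ∩ {z | W z T = z.2}
  have hS : IsCompact S :=
    (isCompact_Icc.prod isCompact_Icc).inter_right (isClosed_eq (hWc T hT2) continuous_snd)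
  have hIcc : -C - 1 ∈ Icc (-C - 1) C := ⟨le_rfl, by linarith⟩
  obtain ⟨x, hx, hxW⟩ := hconv _ hIcc hbot
  obtain ⟨z, hz, hzmax⟩ := hS.exists_isMaxOn ⟨(-C - 1, x), ⟨hIcc, hx⟩, hxW⟩
    continuous_fst.continuousOn
  refine ⟨z.1, hfix z hz.1.1 hz.2, fun lam hlam => ?_⟩
  rcases le_total lam (-C - 1) with h | h
  · exact h.trans hz.1.1.1
  · have hI : lam ∈ Icc (-C - 1) C := ⟨h, riccatiSpectrum_le hT hC hlam⟩
    obtain ⟨y, hy, hyW⟩ := hconv lam hI hlam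
    exact hzmax (show (lam, y) ∈ S from ⟨⟨hI, hy⟩, hyW⟩)

/-! ### The extremal solution has mean zero, and blow-up beyond it -/

theorem Function.Periodic.intervalIntegral_zero_add {f : ℝ → ℝ} {T : ℝ} (hf : Periodic f T)
    (hc : Continuous f) (t : ℝ) :
    ∫ s in (0 : ℝ)..(t + T), f s = (∫ s in (0 : ℝ)..t, f s) + ∫ s in (0 : ℝ)..T, f s := by
  rw [← intervalIntegral.integral_add_adjacent_intervals (hc.intervalIntegrable 0 t)
    (hc.intervalIntegrable t (t + T)), hf.intervalIntegral_add_eq t 0, zero_add]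

theorem continuous_of_forall_hasDerivAt {w w' : ℝ → ℝ} (hw : ∀ t, HasDerivAt w (w' t) t) :
    Continuous w :=
  continuous_iff_continuousAt.2 fun t => (hw t).continuousAt

/-- A periodic Riccati solution of positive mean can be perturbed to a strict lower solution for a
larger parameter. -/
theorem exists_gt_mem_riccatiSpectrum_of_pos {T lam : ℝ} (hT : 0 < T) {p w : ℝ → ℝ}
    (hp : Continuous p) (hpT : Periodic p T) (hwT : Periodic w T)
    (hw : ∀ t, HasDerivAt w (p t - lam - w t ^ 2) t) (hpos : 0 < ∫ s in (0 : ℝ)..T, w s) :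
    ∃ mu ∈ riccatiSpectrum T p, lam < mu := by
  have hwc := continuous_of_forall_hasDerivAt hw
  set I := ∫ s in (0 : ℝ)..T, w s with hI
  set m := I / T with hm
  have hmpos : 0 < m := div_pos hpos hT
  -- Subtracting the mean makes `g` periodic. Then `z = exp g` satisfies `z' = 2 (m - w) z`, which
  -- cancels the cross term `2 e w z` in `(w ± e z) ^ 2`.
  let g : ℝ → ℝ := fun t => 2 * (m * t - ∫ s in (0 : ℝ)..t, w s)
  have hg : ∀ t, HasDerivAt g (2 * (m - w t)) t := fun t => by
    have h1 := (hwc.integral_hasStrictDerivAt 0 t).hasDerivAt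
    have h2 : HasDerivAt (fun s : ℝ => m * s) m t := by simpa using (hasDerivAt_id t).const_mul m
    exact (h2.sub h1).const_mul 2
  have hgT : Periodic g T := fun t => by
    simp only [g, hwT.intervalIntegral_zero_add hwc, ← hI, hm]
    field_simp
    ring
  have hgc := continuous_of_forall_hasDerivAt hg
  obtain ⟨G, hG0, hG⟩ := hgT.exists_abs_le hT hgc
  let z : ℝ → ℝ := fun t => Real.exp (g t)
  have hz : ∀ t, HasDerivAt z (z t * (2 * (m - w t))) t := fun t => (hg t).exp
  have hzT : Periodic z T := fun t => by simp only [z, hgT t]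
  have hzu : ∀ t, z t ≤ Real.exp G := fun t => Real.exp_le_exp.2 (abs_le.1 (hG t)).2
  have hzl : ∀ t, Real.exp (-G) ≤ z t := fun t => Real.exp_le_exp.2 (abs_le.1 (hG t)).1
  have hz0 : ∀ t, 0 < z t := fun t => Real.exp_pos _
  have hGp := Real.exp_pos G
  have hGn := Real.exp_pos (-G)
  -- The lower inequality reads `d + (e z) ^ 2 < 2 m e z`; it holds once `e z ≤ m` and `d < m e z`.
  set e := m / Real.exp G with he
  have hepos : 0 < e := div_pos hmpos hGp
  have hez : ∀ t, e * z t ≤ m := fun t => by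
    calc e * z t ≤ e * Real.exp G := by gcongr; exact hzu t
      _ = m := by rw [he]; field_simp
  set d := m * e * Real.exp (-G) / 2 with hd
  have hdpos : 0 < d := by positivity
  have hdz : ∀ t, d < m * e * z t := fun t => by
    have : m * e * Real.exp (-G) ≤ m * e * z t := by gcongr; exact hzl t
    linarith
  refine ⟨lam + d, ?_, by linarith⟩
  refine exists_periodic_riccati_of_lower_upper hT (A := fun t => w t - e * z t)
    (B := fun t => w t + e * z t) (by fun_prop) (fun t => by simp only [hpT t])
    (fun t => by simp only [hwT t, hzT t]) (fun t => by simp only [hwT t, hzT t])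
    (fun t => (hw t).sub ((hz t).const_mul e)) (fun t => (hw t).add ((hz t).const_mul e))
    (fun t => ?_) (fun t => ?_) ?_
  · have h1 := hdz t
    have h2 : e * z t * (e * z t) ≤ m * (e * z t) :=
      mul_le_mul_of_nonneg_right (hez t) (mul_pos hepos (hz0 t)).le
    nlinarith
  · have h1 : 0 < m * (e * z t) := mul_pos hmpos (mul_pos hepos (hz0 t))
    nlinarith [sq_nonneg (e * z t)]
  · linarith [mul_pos hepos (hz0 0)]

/-- Time reversal `w ↦ -w (-t)` preserves the form of the equation and flips the sign of the mean,
reducing negative mean to positive mean. -/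
theorem mem_riccatiSpectrum_comp_neg {T lam : ℝ} {p : ℝ → ℝ} (h : lam ∈ riccatiSpectrum T p) :
    lam ∈ riccatiSpectrum T fun t => p (-t) := by
  obtain ⟨w, hwT, hw⟩ := h
  refine ⟨fun t => -w (-t), fun t => ?_, fun t => ?_⟩
  · simp only [neg_add, ← sub_eq_add_neg, hwT.sub_eq]
  · have := ((hw (-t)).comp t (hasDerivAt_neg t)).neg
    exact this.congr_deriv (by ring)

theorem exists_gt_mem_riccatiSpectrum {T lam : ℝ} (hT : 0 < T) {p w : ℝ → ℝ}
    (hp : Continuous p) (hpT : Periodic p T) (hwT : Periodic w T)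
    (hw : ∀ t, HasDerivAt w (p t - lam - w t ^ 2) t) (h0 : ∫ s in (0 : ℝ)..T, w s ≠ 0) :
    ∃ mu ∈ riccatiSpectrum T p, lam < mu := by
  rcases h0.lt_or_gt with h | h
  · have hneg : ∫ s in (0 : ℝ)..T, -w (-s) = -∫ s in (0 : ℝ)..T, w s := by
      rw [intervalIntegral.integral_neg, intervalIntegral.integral_comp_neg, neg_zero]
      have := hwT.intervalIntegral_add_eq (-T) 0
      rw [neg_add_cancel, zero_add] at this
      rw [this]
    obtain ⟨mu, hmu, hlt⟩ := exists_gt_mem_riccatiSpectrum_of_pos (p := fun t => p (-t))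
      (w := fun t => -w (-t)) (lam := lam) hT (by fun_prop)
      (fun t => by simp only [neg_add, ← sub_eq_add_neg, hpT.sub_eq])
      (fun t => by simp only [neg_add, ← sub_eq_add_neg, hwT.sub_eq])
      (fun t => ((hw (-t)).comp t (hasDerivAt_neg t)).neg.congr_deriv (by ring))
      (by rw [hneg]; linarith)
    exact ⟨mu, by simpa using mem_riccatiSpectrum_comp_neg hmu, hlt⟩
  · exact exists_gt_mem_riccatiSpectrum_of_pos hT hp hpT hwT hw h

/-- The function `arctan D + k t` is nonincreasing, so `arctan D` would drop by more than its total
range `π` within time `(π + 1) / k`. -/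
theorem false_of_forall_hasDerivAt_le_neg_one_add_sq {D D' : ℝ → ℝ} {k : ℝ} (hk : 0 < k)
    (hD : ∀ t, HasDerivAt D (D' t) t) (h : ∀ t, D' t ≤ -k * (1 + D t ^ 2)) : False := by
  have hd : ∀ t, HasDerivAt (fun t => Real.arctan (D t) + k * t)
      (1 / (1 + D t ^ 2) * D' t + k * 1) t :=
    fun t => (hD t).arctan.add ((hasDerivAt_id t).const_mul k)
  have hanti : Antitone fun t => Real.arctan (D t) + k * t := by
    refine antitone_of_deriv_nonpos (fun t => (hd t).differentiableAt) fun t => ?_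
    rw [(hd t).deriv]
    have hpos : 0 < 1 + D t ^ 2 := by positivity
    have : 1 / (1 + D t ^ 2) * D' t ≤ 1 / (1 + D t ^ 2) * (-k * (1 + D t ^ 2)) := by
      gcongr; exact h t
    have e : 1 / (1 + D t ^ 2) * (-k * (1 + D t ^ 2)) = -k := by field_simp
    linarith
  have h1 := hanti (show (0 : ℝ) ≤ (Real.pi + 1) / k by positivity)
  have e : k * ((Real.pi + 1) / k) = Real.pi + 1 := by field_simp
  simp only [e, mul_zero] at h1
  linarith [Real.neg_pi_div_two_lt_arctan (D ((Real.pi + 1) / k)), Real.arctan_lt_pi_div_two (D 0)]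

/-- A Riccati solution on the whole line cannot exist beyond a parameter with a periodic solution
of mean zero. -/
theorem le_of_forall_hasDerivAt_riccati {T lam mu : ℝ} (hT : 0 < T) {p w u : ℝ → ℝ}
    (hwT : Periodic w T) (hw : ∀ t, HasDerivAt w (p t - lam - w t ^ 2) t)
    (h0 : ∫ s in (0 : ℝ)..T, w s = 0) (hu : ∀ t, HasDerivAt u (p t - mu - u t ^ 2) t) :
    mu ≤ lam := by
  by_contra! hlt
  have hwc := continuous_of_forall_hasDerivAt hw
  let g : ℝ → ℝ := fun t => ∫ s in (0 : ℝ)..t, w s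
  have hg : ∀ t, HasDerivAt g (w t) t := fun t => (hwc.integral_hasStrictDerivAt 0 t).hasDerivAt
  have hgT : Periodic g T := fun t => by
    simp only [g, hwT.intervalIntegral_zero_add hwc, h0, add_zero]
  obtain ⟨G, hG0, hG⟩ := hgT.exists_abs_le hT (continuous_of_forall_hasDerivAt hg)
  -- This integrating factor removes the linear term: `D = z (u - w)` satisfies `D' = -(mu - lam) z
  -- - D ^ 2 / z`. Mean zero keeps `z` between positive constants, and `k` bounds both `(mu - lam)
  -- z` and `1 / z` from below.
  let z : ℝ → ℝ := fun t => Real.exp (2 * g t)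
  have hz : ∀ t, HasDerivAt z (z t * (2 * w t)) t := fun t => ((hg t).const_mul 2).exp
  have hz0 : ∀ t, 0 < z t := fun t => Real.exp_pos _
  have hzu : ∀ t, z t ≤ Real.exp (2 * G) :=
    fun t => Real.exp_le_exp.2 (by linarith [(abs_le.1 (hG t)).2])
  have hzl : ∀ t, Real.exp (-(2 * G)) ≤ z t :=
    fun t => Real.exp_le_exp.2 (by linarith [(abs_le.1 (hG t)).1])
  set k := min (mu - lam) 1 * Real.exp (-(2 * G)) with hk
  have hmin : 0 < min (mu - lam) 1 := lt_min (by linarith) one_pos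
  have hkpos : 0 < k := mul_pos hmin (Real.exp_pos _)
  refine false_of_forall_hasDerivAt_le_neg_one_add_sq hkpos
    (fun t => (hz t).mul ((hu t).sub (hw t))) fun t => ?_
  have h1 : k ≤ (mu - lam) * z t :=
    mul_le_mul (min_le_left _ _) (hzl t) (Real.exp_pos _).le (by linarith)
  have h2 : k * z t ≤ 1 := by
    calc k * z t ≤ 1 * Real.exp (-(2 * G)) * Real.exp (2 * G) := by
          rw [hk]
          gcongr
          · exact min_le_right _ _
          · exact hzu t
      _ = 1 := by rw [one_mul, ← Real.exp_add, neg_add_cancel, Real.exp_zero]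
  have h3 : k * (z t * (u t - w t)) ^ 2 ≤ z t * (u t - w t) ^ 2 := by
    calc k * (z t * (u t - w t)) ^ 2 = k * z t * (z t * (u t - w t) ^ 2) := by ring
      _ ≤ 1 * (z t * (u t - w t) ^ 2) :=
        mul_le_mul_of_nonneg_right h2 (mul_nonneg (hz0 t).le (sq_nonneg _))
      _ = _ := one_mul _
  simp only [Pi.sub_apply, Pi.mul_apply] at *
  linarith

/-! ### Riccati solutions and Hill eigenvalues -/

theorem IsHillSolution.of_riccati {p w g : ℝ → ℝ} {lam : ℝ}
    (hw : ∀ t, HasDerivAt w (p t - lam - w t ^ 2) t) (hg : ∀ t, HasDerivAt g (w t) t) :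
    IsHillSolution p lam fun t => Real.exp (g t) := by
  have h1 : ∀ t, HasDerivAt (fun t => Real.exp (g t)) (Real.exp (g t) * w t) t :=
    fun t => (hg t).exp
  have hd : deriv (fun t => Real.exp (g t)) = fun t => Real.exp (g t) * w t :=
    funext fun t => (h1 t).deriv
  have h2 : ∀ t, HasDerivAt (fun t => Real.exp (g t) * w t)
      (Real.exp (g t) * w t * w t + Real.exp (g t) * (p t - lam - w t ^ 2)) t :=
    fun t => (h1 t).mul (hw t)
  refine ⟨fun t => (h1 t).differentiableAt, ?_, fun t => ?_⟩
  · rw [hd]; exact fun t => (h2 t).differentiableAt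
  · rw [hd, (h2 t).deriv]; ring

theorem Function.Periodic.eq_of_monotone {f : ℝ → ℝ} {T : ℝ} (hf : Periodic f T) (hT : 0 < T)
    (hm : Monotone f) (s t : ℝ) : f s = f t := by
  have key : ∀ s t, f s ≤ f t := fun s t => by
    obtain ⟨n, hn⟩ := exists_nat_ge ((s - t) / T)
    rw [← hf.nat_mul n t]
    exact hm (by rw [div_le_iff₀ hT] at hn; linarith)
  exact (key s t).antisymm (key t s)

theorem Function.Periodic.deriv' {f : ℝ → ℝ} {T : ℝ} (hf : Periodic f T) : Periodic (deriv f) T :=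
  fun t => by rw [← deriv_comp_add_const, hf.funext]

/-- The periodic function `F = (y' - w y) y` has derivative `(lam - mu) y ^ 2 + (y' - w y) ^ 2`. If
`mu < lam`, it is monotone, hence constant, which forces `y = 0`. -/
theorem le_of_periodic_hillSolution {T lam mu : ℝ} (hT : 0 < T) {p w y : ℝ → ℝ}
    (hwT : Periodic w T) (hw : ∀ t, HasDerivAt w (p t - lam - w t ^ 2) t)
    (hy : IsHillSolution p mu y) (hyT : Periodic y T) (hne : ∃ t, y t ≠ 0) : lam ≤ mu := by
  by_contra! hlt
  obtain ⟨t, ht⟩ := hne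
  have h1 : ∀ t, HasDerivAt y (deriv y t) t := fun t => (hy.differentiable t).hasDerivAt
  have h2 : ∀ t, HasDerivAt (deriv y) (deriv (deriv y) t) t :=
    fun t => (hy.differentiable_deriv t).hasDerivAt
  let F : ℝ → ℝ := fun t => (deriv y t - w t * y t) * y t
  have hF : ∀ t, HasDerivAt F ((lam - mu) * y t ^ 2 + (deriv y t - w t * y t) ^ 2) t := by
    intro t
    have := ((h2 t).sub ((hw t).mul (h1 t))).mul (h1 t)
    simp only [Pi.sub_apply, Pi.mul_apply] at this
    refine HasDerivAt.congr_deriv this ?_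
    linear_combination y t * hy.equation t
  have hmono : Monotone F := monotone_of_deriv_nonneg (fun t => (hF t).differentiableAt) fun t => by
    rw [(hF t).deriv]
    have : 0 ≤ lam - mu := by linarith
    positivity
  have hFT : Periodic F T := fun t => by simp only [F, hyT t, hwT t, hyT.deriv' t]
  have h0 := (hF t).unique ((hasDerivAt_const t (F t)).congr_of_eventuallyEq
    (Eventually.of_forall fun s => hFT.eq_of_monotone hT hmono s t))
  have : 0 < (lam - mu) * y t ^ 2 := mul_pos (by linarith) (by positivity)
  nlinarith [sq_nonneg (deriv y t - w t * y t)]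

/-- Over a period `w'` integrates to zero, leaving `∫ (p - lam) = ∫ w ^ 2 ≥ 0`. -/
theorem mul_le_integral_of_mem_riccatiSpectrum {T lam : ℝ} (hT : 0 < T) {p : ℝ → ℝ}
    (hp : Continuous p) (h : lam ∈ riccatiSpectrum T p) :
    lam * T ≤ ∫ t in (0 : ℝ)..T, p t := by
  obtain ⟨w, hwT, hw⟩ := h
  have hwc := continuous_of_forall_hasDerivAt hw
  have h1 : ∫ t in (0 : ℝ)..T, (p t - lam - w t ^ 2) = 0 := by
    rw [intervalIntegral.integral_eq_sub_of_hasDerivAt (fun t _ => hw t)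
      (Continuous.intervalIntegrable (by fun_prop) _ _), ← zero_add T, hwT 0, sub_self]
  have h2 : ∫ t in (0 : ℝ)..T, (p t - lam - w t ^ 2) ≤ ∫ t in (0 : ℝ)..T, (p t - lam) :=
    intervalIntegral.integral_mono_on hT.le (Continuous.intervalIntegrable (by fun_prop) _ _)
      (Continuous.intervalIntegrable (by fun_prop) _ _)
      fun t _ => by linarith [sq_nonneg (w t)]
  rw [h1, intervalIntegral.integral_sub (hp.intervalIntegrable _ _)
    (continuous_const.intervalIntegrable _ _), intervalIntegral.integral_const, smul_eq_mul,
    sub_zero] at h2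
  linarith

/-! ### Centroaffine curves and the Riccati correspondence -/

theorem HasDerivAt.areaForm {u v : ℝ → Fin 2 → ℝ} {u' v' : Fin 2 → ℝ} {t : ℝ}
    (hu : HasDerivAt u u' t) (hv : HasDerivAt v v' t) :
    HasDerivAt (fun s => areaForm (u s) (v s)) (areaForm u' (v t) + areaForm (u t) v') t := by
  rw [hasDerivAt_pi] at hu hv
  refine (((hu 0).mul (hv 1)).sub ((hu 1).mul (hv 0))).congr_deriv ?_
  simp only [_root_.areaForm]
  ring

theorem ContDiff.areaForm {u v : ℝ → Fin 2 → ℝ} (hu : ContDiff ℝ ∞ u) (hv : ContDiff ℝ ∞ v) :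
    ContDiff ℝ ∞ fun s => areaForm (u s) (v s) := by
  rw [contDiff_pi] at hu hv
  exact ((hu 0).mul (hv 1)).sub ((hu 1).mul (hv 0))

theorem Function.Antiperiodic.deriv {f : ℝ → Fin 2 → ℝ} {T : ℝ} (hf : Antiperiodic f T) :
    Antiperiodic (deriv f) T := fun t => by
  rw [← deriv_comp_add_const, hf.funext, deriv.neg]

namespace IsCentroaffine

variable {γ : ℝ → Fin 2 → ℝ}

theorem contDiff_deriv (hγ : IsCentroaffine γ) : ContDiff ℝ ∞ (deriv γ) :=
  (contDiff_infty_iff_deriv.1 hγ.smooth).2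

theorem hasDerivAt (hγ : IsCentroaffine γ) (t : ℝ) : HasDerivAt γ (deriv γ t) t :=
  ((contDiff_infty_iff_deriv.1 hγ.smooth).1 t).hasDerivAt

theorem hasDerivAt_deriv (hγ : IsCentroaffine γ) (t : ℝ) :
    HasDerivAt (deriv γ) (centroaffineCurvature γ t • γ t) t := by
  have h : HasDerivAt (deriv γ) (deriv (deriv γ) t) t :=
    ((contDiff_infty_iff_deriv.1 hγ.contDiff_deriv).1 t).hasDerivAt
  refine h.congr_deriv ?_
  -- Differentiating `[γ, γ'] = 1` gives `[γ, γ''] = 0`; expanding `γ''` in the basis `γ, γ'` then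
  -- leaves only the `γ` component.
  have h1 := ((hγ.hasDerivAt t).areaForm h).unique
    ((hasDerivAt_const t (1 : ℝ)).congr_of_eventuallyEq (Eventually.of_forall hγ.wronskian))
  have h2 := hγ.wronskian t
  simp only [areaForm] at h1 h2
  ext i
  simp only [centroaffineCurvature, areaForm, Pi.smul_apply, smul_eq_mul]
  fin_cases i <;> simp only [Fin.zero_eta, Fin.mk_one]
  · linear_combination (-deriv (deriv γ) t 0) * h2 + deriv γ t 0 * h1
  · linear_combination (-deriv (deriv γ) t 1) * h2 + deriv γ t 1 * h1

theorem contDiff_curvature (hγ : IsCentroaffine γ) : ContDiff ℝ ∞ (centroaffineCurvature γ) :=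
  (contDiff_infty_iff_deriv.1 hγ.contDiff_deriv).2.areaForm hγ.contDiff_deriv

end IsCentroaffine

theorem IsPiAntisymmetric.periodic_curvature {γ : ℝ → Fin 2 → ℝ} (h : IsPiAntisymmetric γ) :
    Periodic (centroaffineCurvature γ) Real.pi := fun t => by
  have h1 := Antiperiodic.deriv h
  simp [centroaffineCurvature, areaForm, h1 t, h1.deriv t]

theorem IsPiAntisymmetric.isClosedCurve {γ : ℝ → Fin 2 → ℝ} (h : IsPiAntisymmetric γ) :
    IsClosedCurve γ :=
  ⟨2 * Real.pi, by positivity, Antiperiodic.periodic_two_mul h⟩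

theorem contDiff_of_riccati {q w : ℝ → ℝ} (hq : ContDiff ℝ ∞ q)
    (hw : ∀ t, HasDerivAt w (q t - w t ^ 2) t) : ContDiff ℝ ∞ w := by
  rw [contDiff_infty]
  intro n
  induction n with
  | zero => exact contDiff_zero.2 (continuous_of_forall_hasDerivAt hw)
  | succ n ih =>
    rw [Nat.cast_add, Nat.cast_one, contDiff_succ_iff_deriv]
    refine ⟨fun t => (hw t).differentiableAt, by simp, ?_⟩
    rw [show deriv w = fun t => q t - w t ^ 2 from funext fun t => (hw t).deriv]
    exact (contDiff_infty.1 hq n).sub (ih.pow 2)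

/-- A `c`-related centroaffine curve `δ` yields the global Riccati solution `-[δ, γ'] / c`. -/
theorem CRelated.exists_riccati {γ δ : ℝ → Fin 2 → ℝ} {c : ℝ} (hc : c ≠ 0)
    (hγ : IsCentroaffine γ) (hδ : IsCentroaffine δ) (h : CRelated c γ δ) :
    ∃ u : ℝ → ℝ, ∀ t, HasDerivAt u (centroaffineCurvature γ t - -(1 / c ^ 2) - u t ^ 2) t := by
  refine ⟨fun t => -areaForm (δ t) (deriv γ t) / c, fun t => ?_⟩
  refine (((hδ.hasDerivAt t).areaForm (hγ.hasDerivAt_deriv t)).neg.div_const c).congr_deriv ?_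
  have h1 := ((hγ.hasDerivAt t).areaForm (hδ.hasDerivAt t)).unique
    ((hasDerivAt_const t c).congr_of_eventuallyEq (Eventually.of_forall h))
  have h2 := h t
  have h3 := hγ.wronskian t
  have h4 := hδ.wronskian t
  generalize centroaffineCurvature γ t = p
  simp only [areaForm, Pi.smul_apply, smul_eq_mul] at h1 h2 h3 h4 ⊢
  generalize γ t 0 = x0 at *
  generalize γ t 1 = x1 at *
  generalize deriv γ t 0 = y0 at *
  generalize deriv γ t 1 = y1 at *
  generalize δ t 0 = d0 at *
  generalize δ t 1 = d1 at *
  generalize deriv δ t 0 = e0 at *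
  generalize deriv δ t 1 = e1 at *
  -- The Plücker relation among `γ, γ', δ, δ'`, combined with `[γ', δ] + [γ, δ'] = 0`, gives `c [δ',
  -- γ'] = [δ, γ'] ^ 2 - 1`.
  have key : c * (e0 * y1 - e1 * y0) = (d0 * y1 - d1 * y0) ^ 2 - 1 := by
    linear_combination (-(e0 * y1 - e1 * y0)) * h2 + (d0 * y1 - d1 * y0) * h1 -
      (d0 * e1 - d1 * e0) * h3 - h4
  field_simp
  linear_combination p * c * h2 - key

theorem exists_cRelated_of_riccati {γ : ℝ → Fin 2 → ℝ} {c : ℝ} {w : ℝ → ℝ} (hc : c ≠ 0)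
    (hγ : IsCentroaffine γ) (hanti : IsPiAntisymmetric γ) (hwT : Periodic w Real.pi)
    (hw : ∀ t, HasDerivAt w (centroaffineCurvature γ t - -(1 / c ^ 2) - w t ^ 2) t) :
    ∃ δ : ℝ → Fin 2 → ℝ, IsCentroaffine δ ∧ IsPiAntisymmetric δ ∧ CRelated c γ δ := by
  have hws := contDiff_of_riccati (q := fun t => centroaffineCurvature γ t - -(1 / c ^ 2))
    (hγ.contDiff_curvature.sub contDiff_const) hw
  have h' := Antiperiodic.deriv hanti
  have hδ : ∀ t, HasDerivAt (fun s => c • (deriv γ s - w s • γ s))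
      (c • (centroaffineCurvature γ t • γ t - (w t • deriv γ t +
        (centroaffineCurvature γ t - -(1 / c ^ 2) - w t ^ 2) • γ t))) t :=
    fun t => ((hγ.hasDerivAt_deriv t).sub ((hw t).smul (hγ.hasDerivAt t))).const_smul c
  refine ⟨fun t => c • (deriv γ t - w t • γ t), ⟨?_, fun t => ?_⟩, fun t => ?_, fun t => ?_⟩
  · exact (hγ.contDiff_deriv.sub (hws.smul hγ.smooth)).const_smul c
  · rw [(hδ t).deriv]
    have h2 := hγ.wronskian t
    simp only [areaForm, Pi.smul_apply, Pi.sub_apply, Pi.add_apply, smul_eq_mul] at h2 ⊢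
    field_simp
    linear_combination h2
  · simp only [h' t, hwT t, hanti t]
    module
  · have h2 := hγ.wronskian t
    simp only [areaForm, Pi.smul_apply, Pi.sub_apply, smul_eq_mul] at h2 ⊢
    linear_combination c * h2

/-- For `lam = 0` the vector `V = γ' - w γ` satisfies `V' = -w V`, so it is a positive multiple of a
fixed vector. Being `π`-antiperiodic it must vanish, contradicting `[γ, V] = 1`. -/
theorem zero_notMem_riccatiSpectrum {γ : ℝ → Fin 2 → ℝ} (hγ : IsCentroaffine γ)
    (hanti : IsPiAntisymmetric γ) :
    (0 : ℝ) ∉ riccatiSpectrum Real.pi (centroaffineCurvature γ) := by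
  rintro ⟨w, hwT, hw⟩
  have hwc := continuous_of_forall_hasDerivAt hw
  have h' := Antiperiodic.deriv hanti
  have hg : ∀ t, HasDerivAt (fun t => ∫ s in (0 : ℝ)..t, w s) (w t) t :=
    fun t => (hwc.integral_hasStrictDerivAt 0 t).hasDerivAt
  let V : ℝ → Fin 2 → ℝ := fun t => deriv γ t - w t • γ t
  have hV : ∀ t, HasDerivAt V (-(w t) • V t) t := fun t => by
    refine ((hγ.hasDerivAt_deriv t).sub ((hw t).smul (hγ.hasDerivAt t))).congr_deriv ?_
    module
  let E : ℝ → ℝ := fun t => Real.exp (∫ s in (0 : ℝ)..t, w s)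
  have hE : ∀ t, HasDerivAt (fun t => E t • V t) 0 t := fun t => by
    refine ((hg t).exp.smul (hV t)).congr_deriv ?_
    module
  have hconst := is_const_of_deriv_eq_zero (fun t => (hE t).differentiableAt)
    (fun t => (hE t).deriv) Real.pi 0
  have hVpi : V Real.pi = -V 0 := by
    have e1 := h' 0
    have e2 := hwT 0
    have e3 := hanti 0
    rw [zero_add] at e1 e2 e3
    simp only [V, e1, e2, e3]
    module
  have hV0 : V 0 = 0 := by
    have : (E Real.pi + E 0) • V 0 = 0 := by
      rw [hVpi] at hconst
      rw [add_smul, ← hconst, smul_neg, add_neg_cancel]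
    exact (smul_eq_zero.1 this).resolve_left
      (add_pos (Real.exp_pos _) (Real.exp_pos _)).ne'
  have h2 := hγ.wronskian 0
  have e0 := congrFun hV0 0
  have e1 := congrFun hV0 1
  simp only [V, Pi.sub_apply, Pi.smul_apply, smul_eq_mul, Pi.zero_apply, areaForm] at h2 e0 e1
  have : (0 : ℝ) = 1 := by linear_combination h2 - γ 0 0 * e1 + γ 0 1 * e0
  exact zero_ne_one this

/-! ### Assembly of the theorem -/

theorem abs_le_one_div_sqrt_iff {c L : ℝ} (hL : 0 < L) :
    |c| ≤ 1 / Real.sqrt L ↔ L * c ^ 2 ≤ 1 := by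
  rw [le_div_iff₀ (Real.sqrt_pos.2 hL), ← abs_of_pos (Real.sqrt_pos.2 hL), ← abs_mul,
    ← sq_le_one_iff_abs_le_one, mul_pow, Real.sq_sqrt hL.le, mul_comm]

theorem mainTheorem1 (γ : ℝ → Fin 2 → ℝ) (hγ : IsCentroaffine γ) (hanti : IsPiAntisymmetric γ) :
    ∃ lam0 : ℝ,
      IsLeast (periodicEigenvalues (centroaffineCurvature γ)) lam0 ∧
      lam0 < 0 ∧
      (∀ c : ℝ,
        (∃ δ : ℝ → Fin 2 → ℝ, IsCentroaffine δ ∧ IsClosedCurve δ ∧ CRelated c γ δ) ↔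
          |c| ≤ 1 / Real.sqrt (-lam0)) ∧
      (∀ c : ℝ,
        (∃ δ : ℝ → Fin 2 → ℝ, IsCentroaffine δ ∧ IsPiAntisymmetric δ ∧ CRelated c γ δ) ↔
          |c| ≤ 1 / Real.sqrt (-lam0)) ∧
      lam0 ≤ -negMean (centroaffineCurvature γ) ∧
      (0 < negMean (centroaffineCurvature γ) →
        ∀ c : ℝ,
          (∃ δ : ℝ → Fin 2 → ℝ, IsCentroaffine δ ∧ IsClosedCurve δ ∧ CRelated c γ δ) →
            |c| ≤ 1 / Real.sqrt (negMean (centroaffineCurvature γ))) := by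
  have hpc := hγ.contDiff_curvature.continuous
  have hpT := hanti.periodic_curvature
  have hpi := Real.pi_pos
  obtain ⟨lam0, hmem, hmax⟩ := exists_isGreatest_riccatiSpectrum hpi hpc hpT
  obtain ⟨w, hwT, hw⟩ := id hmem
  have hwc := continuous_of_forall_hasDerivAt hw
  have hint : ∫ s in (0 : ℝ)..Real.pi, w s = 0 := by
    by_contra h
    obtain ⟨mu, hmu, hlt⟩ := exists_gt_mem_riccatiSpectrum hpi hpc hpT hwT hw h
    exact hlt.not_ge (hmax hmu)
  have hneg : lam0 < 0 := by
    by_contra! h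
    refine zero_notMem_riccatiSpectrum hγ hanti ?_
    rcases h.eq_or_lt with h | h
    · exact h ▸ hmem
    · exact mem_riccatiSpectrum_of_lt hpi hpc hpT hmem h
  have hnec : ∀ c : ℝ, (∃ δ : ℝ → Fin 2 → ℝ, IsCentroaffine δ ∧ CRelated c γ δ) →
      -lam0 * c ^ 2 ≤ 1 := by
    rintro c ⟨δ, hδ, hrel⟩
    rcases eq_or_ne c 0 with rfl | hc
    · norm_num
    · obtain ⟨u, hu⟩ := hrel.exists_riccati hc hγ hδ
      have h1 := le_of_forall_hasDerivAt_riccati hpi hwT hw hint hu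
      have hc2 : 0 < c ^ 2 := by positivity
      rw [neg_le, le_div_iff₀ hc2] at h1
      exact h1
  have hsuff : ∀ c : ℝ, -lam0 * c ^ 2 ≤ 1 →
      ∃ δ : ℝ → Fin 2 → ℝ, IsCentroaffine δ ∧ IsPiAntisymmetric δ ∧ CRelated c γ δ := by
    intro c h
    rcases eq_or_ne c 0 with rfl | hc
    -- For `c = 0` the curve `γ` is related to itself.
    · exact ⟨γ, hγ, hanti, fun t => by simp only [areaForm]; ring⟩
    · have hc2 : 0 < c ^ 2 := by positivity
      have hle : -(1 / c ^ 2) ≤ lam0 := by rw [neg_le, le_div_iff₀ hc2]; exact h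
      have : -(1 / c ^ 2) ∈ riccatiSpectrum Real.pi (centroaffineCurvature γ) := by
        rcases hle.eq_or_lt with h | h
        · exact h ▸ hmem
        · exact mem_riccatiSpectrum_of_lt hpi hpc hpT hmem h
      obtain ⟨u, huT, hu⟩ := this
      exact exists_cRelated_of_riccati hc hγ hanti huT hu
  have hmean : lam0 ≤ -negMean (centroaffineCurvature γ) := by
    have h := mul_le_integral_of_mem_riccatiSpectrum hpi hpc hmem
    rw [← le_div_iff₀ hpi] at h
    rw [negMean]
    refine h.trans (le_of_eq ?_)
    ring
  refine ⟨lam0, ⟨?_, ?_⟩, hneg, fun c => ?_, fun c => ?_, hmean, ?_⟩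
  · refine ⟨_, IsHillSolution.of_riccati hw
      fun t => (hwc.integral_hasStrictDerivAt 0 t).hasDerivAt, fun t => ?_, 0,
      (Real.exp_pos _).ne'⟩
    simp only [hwT.intervalIntegral_zero_add hwc, hint, add_zero]
  · rintro mu ⟨y, hy, hyT, hne⟩
    exact le_of_periodic_hillSolution hpi hwT hw hy hyT hne
  · rw [abs_le_one_div_sqrt_iff (neg_pos.2 hneg)]
    refine ⟨fun ⟨δ, h1, _, h2⟩ => hnec c ⟨δ, h1, h2⟩, fun h => ?_⟩
    obtain ⟨δ, h1, h2, h3⟩ := hsuff c h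
    exact ⟨δ, h1, h2.isClosedCurve, h3⟩
  · rw [abs_le_one_div_sqrt_iff (neg_pos.2 hneg)]
    exact ⟨fun ⟨δ, h1, _, h2⟩ => hnec c ⟨δ, h1, h2⟩, hsuff c⟩
  · rintro hP c ⟨δ, h1, -, h2⟩
    rw [abs_le_one_div_sqrt_iff hP]
    -- Since `P ≤ -lam0`, it follows that `P c ^ 2 ≤ -lam0 c ^ 2 ≤ 1`.
    nlinarith [hnec c ⟨δ, h1, h2⟩, sq_nonneg c]
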